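/- Let $\Omega\subset\mathbb R^n$ be open, let $(X,d)$ be a metric space, and let $f:\Omega\to X$ be $L$-Lipschitz. We say that $f$ is metrically differentiable at $x\in\Omega$ if there is a (necessarily unique) seminorm $\operatorname{md}(f,x)$ on $\mathbb R^n$ such that $$\lim_{y\to x}\frac{d(f(y),f(x))-\operatorname{md}(f,x)(y-x)}{|y-x|}=0 .$$ The rank of a seminorm $\sigma$ on $\mathbb R^n$ is $\operatorname{rank}\sigma=n-\dim\{v\in\mathbb R^n:\sigma(v)=0\}$. For $0\le k\le n$ let $E_k$ be the set of those $x\in\Omega$ at which $f$ is metrically differentiable with $\operatorname{rank}\operatorname{md}(f,x)=k$. Then (Lebesgue) almost every $x\in E_k$ has the following property: for every integer $m\ge 1$ there exists $r_{x,m}>0$ such that for all $0<r<r_{x,m}$ the open ball $B(x,r)$ is contained in $\Omega$ and - if $k>0$, then $f(B(x,r))$ can be covered by $m^k$ open balls of $X$, each of radius $3\sqrt{k}\,Lr/m$; - if $k=0$, then $f(B(x,r))$ is contained in one open ball of $X$ of radius $r/m$. -/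

import Mathlib

open MeasureTheory Filter Topology
open scoped NNReal

/-- The null space `N_σ = {v : σ v = 0}` of a seminorm, as a linear subspace. -/
def Seminorm.nullSpace {n : ℕ} (σ : Seminorm ℝ (EuclideanSpace ℝ (Fin n))) :
    Submodule ℝ (EuclideanSpace ℝ (Fin n)) where
  carrier := {v | σ v = 0}
  zero_mem' := map_zero σ
  add_mem' := by
    intro v w hv hw
    have hv' : σ v = 0 := hv
    have hw' : σ w = 0 := hw
    refine le_antisymm ?_ (apply_nonneg σ _)
    simpa [hv', hw'] using map_add_le_add σ v w
  smul_mem' := by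
    intro c v hv
    have hv' : σ v = 0 := hv
    show σ (c • v) = 0
    rw [map_smul_eq_mul, hv', mul_zero]

/-- The rank of a seminorm on `ℝⁿ`: `n - dim N_σ`. The subtraction never truncates. -/
noncomputable def Seminorm.rank {n : ℕ} (σ : Seminorm ℝ (EuclideanSpace ℝ (Fin n))) : ℕ :=
  n - Module.finrank ℝ σ.nullSpace

/-- The seminorm `σ` is a metric derivative of `f` at `x`:
`(d (f y) (f x) - σ (y - x)) / |y - x| → 0` as `y → x`, `y ≠ x`. If `x` is an interior point of
`Ω`, this depends only on the restriction of `f` to `Ω`. -/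
def HasMetricDerivAt {n : ℕ} {X : Type*} [MetricSpace X] (f : EuclideanSpace ℝ (Fin n) → X)
    (σ : Seminorm ℝ (EuclideanSpace ℝ (Fin n))) (x : EuclideanSpace ℝ (Fin n)) : Prop :=
  Tendsto (fun y => (dist (f y) (f x) - σ (y - x)) / ‖y - x‖) (𝓝[≠] x) (𝓝 0)

/-- The metric derivative is unique, so that one may speak of its rank. -/
theorem HasMetricDerivAt.unique {n : ℕ} {X : Type*} [MetricSpace X]
    {f : EuclideanSpace ℝ (Fin n) → X} {σ τ : Seminorm ℝ (EuclideanSpace ℝ (Fin n))}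
    {x : EuclideanSpace ℝ (Fin n)} (hσ : HasMetricDerivAt f σ x) (hτ : HasMetricDerivAt f τ x) :
    σ = τ := by
  ext v
  by_cases hv : v = 0
  · simp [hv]
  have hline : Tendsto (fun t : ℝ => x + t • v) (𝓝[>] 0) (𝓝[≠] x) := by
    refine tendsto_nhdsWithin_iff.2 ⟨?_, ?_⟩
    · have hc : Continuous (fun t : ℝ => x + t • v) := by fun_prop
      have := hc.tendsto 0
      simp only [zero_smul, add_zero] at this
      exact this.mono_left nhdsWithin_le_nhds
    · filter_upwards [self_mem_nhdsWithin] with t ht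
      have ht' : t ≠ 0 := ne_of_gt ht
      simp [ht', hv]
  have h := (hσ.sub hτ).comp hline
  have hconst : Tendsto (fun _ : ℝ => (τ v - σ v) / ‖v‖) (𝓝[>] 0) (𝓝 (0 - 0)) := by
    refine h.congr' ?_
    filter_upwards [self_mem_nhdsWithin] with t ht
    have ht' : (0 : ℝ) < t := ht
    have hv' : ‖v‖ ≠ 0 := norm_ne_zero_iff.2 hv
    simp only [Function.comp, add_sub_cancel_left, map_smul_eq_mul, norm_smul, Real.norm_eq_abs,
      abs_of_pos ht']
    field_simp
    ring
  have h0 := tendsto_nhds_unique hconst tendsto_const_nhds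
  have hv' : ‖v‖ ≠ 0 := norm_ne_zero_iff.2 hv
  rw [sub_zero, eq_comm, div_eq_zero_iff] at h0
  rcases h0 with h0 | h0
  · linarith
  · exact absurd h0 hv'

/-- `E_k`: the points of `Ω` at which `f` is metrically differentiable with a metric derivative
of rank `k`. -/
def metricRankSet {n : ℕ} {X : Type*} [MetricSpace X] (f : EuclideanSpace ℝ (Fin n) → X)
    (Ω : Set (EuclideanSpace ℝ (Fin n))) (k : ℕ) : Set (EuclideanSpace ℝ (Fin n)) :=
  {x | x ∈ Ω ∧ ∃ σ : Seminorm ℝ (EuclideanSpace ℝ (Fin n)), HasMetricDerivAt f σ x ∧ σ.rank = k}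

/-! Metric differentiability at `x` makes `f` nearly constant along the null space `N` of `σ` only
when starting from `x`; the crux, `LipschitzOnWith.ae_dist_add_nullSpace_le`, is to start from any
nearby `x + v`. Sort points into countably many classes by approximate derivative (`C(K, ℝ)` is
separable) and by the scale at which it controls increments. Almost every point is a density point
of its class, so some `z` of that class lies very close to `x + v`; its derivative is small on `N`,
and the Lipschitz bound carries this from `z` to `x + v`. Hence `f` on the ball is close to `f` on
its projection to the `k`-dimensional space `Nᗮ`, and the Lipschitz image of a grid there gives the
cover. -/

/-! ### Density points of arbitrary sets -/

/-- Almost every point `x` of an arbitrary set `A` is approximated by `A` at all small scales: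
every point of `closedBall x r` is within `η * r` of `A`. -/
theorem ae_eventually_exists_mem_dist_le {n : ℕ} (A : Set (EuclideanSpace ℝ (Fin n))) {η : ℝ}
    (hη : 0 < η) (hη1 : η ≤ 1) :
    ∀ᵐ x ∂(volume : Measure (EuclideanSpace ℝ (Fin n))), x ∈ A →
      ∀ᶠ r in 𝓝[>] (0 : ℝ), ∀ y ∈ Metric.closedBall x r, ∃ z ∈ A, dist z y ≤ η * r := by
  -- This density theorem needs no measurability of `A`, which matters for the classes used later.
  have hden := ae_imp_of_ae_restrict
    (Besicovitch.ae_tendsto_measure_inter_div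
      (volume : Measure (EuclideanSpace ℝ (Fin n))) A)
  filter_upwards [hden] with x hx hxA
  have hdouble : Tendsto (fun r : ℝ => 2 * r) (𝓝[>] 0) (𝓝[>] 0) := by
    refine tendsto_nhdsWithin_iff.2 ⟨?_, ?_⟩
    · have hc : Continuous (fun r : ℝ => 2 * r) := by fun_prop
      have := hc.tendsto 0
      rw [mul_zero] at this
      exact this.mono_left nhdsWithin_le_nhds
    · filter_upwards [self_mem_nhdsWithin] with r hr
      have : (0 : ℝ) < r := hr
      simpa using this
  -- The volume ratio of balls of radii `η * r` and `2 * r`: a hole of the smaller size would keep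
  -- the density of `A` at most `1 - c`.
  set c : ENNReal := ENNReal.ofReal ((η / 2) ^ n) with hc
  have hc0 : c ≠ 0 := by
    rw [hc, Ne, ENNReal.ofReal_eq_zero, not_le]
    positivity
  have hc1 : c ≤ 1 := by
    rw [hc, ENNReal.ofReal_le_one]
    exact pow_le_one₀ (by positivity) (by linarith)
  have hlt : 1 - c < 1 := ENNReal.sub_lt_self ENNReal.one_ne_top one_ne_zero hc0
  filter_upwards [((hx hxA).comp hdouble).eventually (lt_mem_nhds hlt), self_mem_nhdsWithin]
    with r hr hr0 y hy
  have hr0 : 0 < r := hr0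
  by_contra! hcon
  have hsub : Metric.closedBall y (η * r) ⊆ Metric.closedBall x (2 * r) := by
    refine Metric.closedBall_subset_closedBall' ?_
    have := Metric.mem_closedBall.1 hy
    nlinarith
  have hdisj : Disjoint (A ∩ Metric.closedBall x (2 * r)) (Metric.closedBall y (η * r)) := by
    rw [Set.disjoint_left]
    intro z hz hzy
    exact absurd (Metric.mem_closedBall.1 hzy) (not_le.2 (hcon z hz.1))
  have hle : volume (A ∩ Metric.closedBall x (2 * r)) + volume (Metric.closedBall y (η * r))
      ≤ volume (Metric.closedBall x (2 * r)) := by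
    rw [← measure_union hdisj measurableSet_closedBall]
    exact measure_mono (Set.union_subset Set.inter_subset_right hsub)
  have hsmall : volume (Metric.closedBall y (η * r))
      = c * volume (Metric.closedBall x (2 * r)) := by
    rw [Measure.addHaar_closedBall _ _ (by positivity : 0 ≤ η * r),
      Measure.addHaar_closedBall _ _ (by positivity : 0 ≤ 2 * r), ← mul_assoc, hc,
      ← ENNReal.ofReal_mul (by positivity), finrank_euclideanSpace_fin, ← mul_pow]
    congr 3
    ring
  have hB0 : volume (Metric.closedBall x (2 * r)) ≠ 0 :=
    (Metric.measure_closedBall_pos _ _ (by positivity)).ne'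
  have hBt : volume (Metric.closedBall x (2 * r)) ≠ ⊤ := measure_closedBall_lt_top.ne
  have hr' : (1 - c) * volume (Metric.closedBall x (2 * r))
      < volume (A ∩ Metric.closedBall x (2 * r)) :=
    (ENNReal.lt_div_iff_mul_lt (Or.inl hB0) (Or.inl hBt)).1 hr
  have hct : c * volume (Metric.closedBall x (2 * r)) ≠ ⊤ :=
    ENNReal.mul_ne_top (ne_top_of_le_ne_top ENNReal.one_ne_top hc1) hBt
  have := ENNReal.add_lt_add_right hct hr'
  rw [← add_mul, tsub_add_cancel_of_le hc1, one_mul, ← hsmall] at this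
  exact absurd hle (not_le.2 this)

/-! ### Near-constancy along the null space -/

theorem Seminorm.continuous_euclideanSpace {n : ℕ}
    (σ : Seminorm ℝ (EuclideanSpace ℝ (Fin n))) : Continuous σ :=
  σ.convexOn.locallyLipschitz.continuous

/-- A metric derivative bounds increments from above, uniformly on small balls. -/
theorem HasMetricDerivAt.exists_dist_le {n : ℕ} {X : Type*} [MetricSpace X]
    {f : EuclideanSpace ℝ (Fin n) → X} {σ : Seminorm ℝ (EuclideanSpace ℝ (Fin n))}
    {x : EuclideanSpace ℝ (Fin n)} (h : HasMetricDerivAt f σ x) {ε : ℝ} (hε : 0 < ε) :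
    ∃ δ > 0, ∀ w, ‖w‖ < δ → dist (f (x + w)) (f x) ≤ σ w + ε * ‖w‖ := by
  have hev := h.eventually (gt_mem_nhds hε)
  rw [eventually_nhdsWithin_iff, Metric.eventually_nhds_iff] at hev
  obtain ⟨δ, hδ, hev⟩ := hev
  refine ⟨δ, hδ, fun w hw => ?_⟩
  by_cases hw0 : w = 0
  · simp [hw0]
  have := hev (y := x + w) (by simpa [dist_eq_norm] using hw) (by simpa using hw0)
  rw [add_sub_cancel_left, div_lt_iff₀ (norm_pos_iff.2 hw0)] at this
  linarith

/-- At almost every point of metric differentiability, translations along the null space of the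
metric derivative move the values of `f` by little, also away from the base point. -/
theorem LipschitzOnWith.ae_dist_add_nullSpace_le {n : ℕ} {X : Type*} [MetricSpace X]
    {Ω : Set (EuclideanSpace ℝ (Fin n))} (hΩ : IsOpen Ω) {f : EuclideanSpace ℝ (Fin n) → X}
    {L : ℝ≥0} (hf : LipschitzOnWith L f Ω) {ε : ℝ} (hε : 0 < ε) :
    ∀ᵐ x ∂(volume : Measure (EuclideanSpace ℝ (Fin n))), x ∈ Ω → ∀ σ, HasMetricDerivAt f σ x →
      ∀ᶠ r in 𝓝[>] (0 : ℝ), ∀ v, ‖v‖ ≤ r → ∀ w ∈ σ.nullSpace, ‖w‖ ≤ r →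
        dist (f (x + v + w)) (f (x + v)) ≤ ε * r := by
  -- `2 * L` pays for moving both endpoints to `z` and back; `3` pays for `τ w ≤ 2 * η * ‖w‖` plus
  -- the differentiation error.
  obtain ⟨η, hη, hη1, hηε⟩ : ∃ η : ℝ, 0 < η ∧ η ≤ 1 ∧ (2 * L + 3) * η ≤ ε := by
    have hL : (0 : ℝ) < 2 * L + 3 := by positivity
    refine ⟨min 1 (ε / (2 * L + 3)), by positivity, min_le_left _ _, ?_⟩
    calc (2 * (L : ℝ) + 3) * min 1 (ε / (2 * L + 3))
        ≤ (2 * L + 3) * (ε / (2 * L + 3)) := by gcongr; exact min_le_right _ _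
      _ = ε := by field_simp
  let K := Metric.closedBall (0 : EuclideanSpace ℝ (Fin n)) 1
  have : CompactSpace K := isCompact_iff_compactSpace.1 (isCompact_closedBall _ _)
  let g : ℕ → C(K, ℝ) := TopologicalSpace.denseSeq _
  -- Quantifying over `τ` inside keeps the family countable, so the exceptional null set does not
  -- depend on `σ`.
  let A : ℕ → ℕ → Set (EuclideanSpace ℝ (Fin n)) := fun i j =>
    {z | ∃ τ : Seminorm ℝ (EuclideanSpace ℝ (Fin n)), (∀ u : K, |τ u - g i u| ≤ η) ∧
      ∀ w, ‖w‖ < 1 / ((j : ℝ) + 1) → dist (f (z + w)) (f z) ≤ τ w + η * ‖w‖}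
  have hae := ae_all_iff.2 fun i => ae_all_iff.2 fun j =>
    ae_eventually_exists_mem_dist_le (A i j) hη hη1
  filter_upwards [hae] with x hx hxΩ σ hσ
  let s : C(K, ℝ) := ⟨fun u => σ u, σ.continuous_euclideanSpace.comp continuous_subtype_val⟩
  obtain ⟨i, hi⟩ : ∃ i, dist s (g i) < η :=
    (TopologicalSpace.denseRange_denseSeq C(K, ℝ)).exists_dist_lt s hη
  have hsg : ∀ u : K, |σ u - g i u| ≤ η := fun u =>
    (ContinuousMap.dist_apply_le_dist (f := s) (g := g i) u).trans hi.le
  obtain ⟨δ, hδ, hd⟩ := hσ.exists_dist_le hη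
  obtain ⟨j, hj⟩ := exists_nat_one_div_lt hδ
  have hxA : x ∈ A i j := ⟨σ, hsg, fun w hw => hd w (hw.trans hj)⟩
  obtain ⟨R, hR, hRΩ⟩ := Metric.isOpen_iff.1 hΩ x hxΩ
  have hj0 : (0 : ℝ) < 1 / ((j : ℝ) + 1) := by positivity
  filter_upwards [hx i j hxA, self_mem_nhdsWithin,
    nhdsWithin_le_nhds (gt_mem_nhds hj0),
    nhdsWithin_le_nhds (gt_mem_nhds (show 0 < R / 3 by positivity))]
    with r happ hr0 hrj hrR v hv w hw hwr
  have hr0 : 0 < r := hr0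
  obtain ⟨z, ⟨τ, hτ, hz⟩, hzv⟩ := happ (x + v) (by simpa [dist_eq_norm] using hv)
  have hΩmem : ∀ p, dist p x ≤ 3 * r → p ∈ Ω := fun p hp =>
    hRΩ (Metric.mem_ball.2 (by linarith))
  -- On the unit sphere `τ` and `σ` are both `η`-close to `g i`, and `σ w = 0`; homogeneity does the
  -- rest.
  have hτw : τ w ≤ 2 * η * ‖w‖ := by
    by_cases hw0 : w = 0
    · simp [hw0]
    have hwn : 0 < ‖w‖ := norm_pos_iff.2 hw0
    have hu : ‖w‖⁻¹ • w ∈ K := by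
      simp [K, norm_smul, hwn.ne']
    have h1 := abs_le.1 (hτ ⟨_, hu⟩)
    have h2 := abs_le.1 (hsg ⟨_, hu⟩)
    have hσw : σ w = 0 := hw
    simp only [map_smul_eq_mul, hσw, mul_zero, norm_inv, norm_norm] at h1 h2
    have h3 : ‖w‖⁻¹ * τ w ≤ 2 * η := by linarith [h1.2, h2.1]
    rw [inv_mul_le_iff₀ hwn] at h3
    linarith
  have hxv : dist (x + v) x ≤ r := by simpa [dist_eq_norm] using hv
  have hzx : dist z x ≤ 2 * r := by
    have := dist_triangle z (x + v) x
    nlinarith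
  have hzw : dist (z + w) z ≤ r := by simpa [dist_eq_norm] using hwr
  have hxvw : dist (x + v + w) (x + v) ≤ r := by simpa [dist_eq_norm] using hwr
  have hshift : dist (x + v + w) (z + w) = dist z (x + v) := by
    rw [dist_add_right, dist_comm]
  have e1 := hf.dist_le_mul _ (hΩmem (x + v + w) (by
    linarith [dist_triangle (x + v + w) (x + v) x])) _ (hΩmem (z + w) (by
    linarith [dist_triangle (z + w) z x]))
  have e2 := hf.dist_le_mul _ (hΩmem z (by linarith)) _ (hΩmem (x + v) (by linarith))
  have e3 := hz w (hwr.trans_lt hrj)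
  rw [hshift] at e1
  have hLz : (L : ℝ) * dist z (x + v) ≤ L * (η * r) := by gcongr
  have hηw : η * ‖w‖ ≤ η * r := by gcongr
  calc dist (f (x + v + w)) (f (x + v))
      ≤ dist (f (x + v + w)) (f (z + w)) + dist (f (z + w)) (f z) + dist (f z) (f (x + v)) :=
        dist_triangle4 _ _ _ _
    _ ≤ (2 * L + 3) * η * r := by linarith
    _ ≤ ε * r := by gcongr

/-! ### Grids and ranks -/

/-- The ball of radius `r` in `ℝᵏ` is covered by `mᵏ` balls of radius `√k * r / m`. -/
theorem EuclideanSpace.exists_grid_dist_le (k : ℕ) {m : ℕ} (hm : 1 ≤ m) {r : ℝ} (hr : 0 < r) :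
    ∃ c : Fin (m ^ k) → EuclideanSpace ℝ (Fin k), ∀ p, ‖p‖ < r →
      ∃ i, dist p (c i) ≤ √(k : ℝ) * (r / m) := by
  have hm0 : (0 : ℝ) < m := by exact_mod_cast hm
  -- Midpoints of the `m` equal subintervals of `[-r, r]`.
  let t : Fin m → ℝ := fun j => -r + (2 * (j : ℝ) + 1) * (r / m)
  have hline : ∀ a : ℝ, |a| < r → ∃ j, |a - t j| ≤ r / m := by
    intro a ha
    rw [abs_lt] at ha
    set q : ℝ := (a + r) * m / (2 * r) with hq
    have hq0 : 0 ≤ q := by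
      have : 0 < a + r := by linarith
      positivity
    have hqm : q < m := by
      rw [hq, div_lt_iff₀ (by positivity)]
      nlinarith
    refine ⟨⟨⌊q⌋₊, (Nat.floor_lt hq0).2 hqm⟩, ?_⟩
    have h1 := Nat.floor_le hq0
    have h2 := Nat.lt_floor_add_one q
    have ha' : a = -r + 2 * q * (r / m) := by
      rw [hq]; field_simp; ring
    have hrm : 0 < r / m := by positivity
    have hsub : a - t ⟨⌊q⌋₊, (Nat.floor_lt hq0).2 hqm⟩
        = (2 * (q - ⌊q⌋₊) - 1) * (r / m) := by
      simp only [t]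
      linarith
    rw [hsub, abs_mul, abs_of_pos hrm]
    refine mul_le_of_le_one_left hrm.le (abs_le.2 ⟨by linarith, by linarith⟩)
  refine ⟨fun i => WithLp.toLp 2 fun l => t (finFunctionFinEquiv.symm i l), fun p hp => ?_⟩
  choose J hJ using fun l => hline (p l)
    ((PiLp.norm_apply_le p l).trans_lt hp)
  refine ⟨finFunctionFinEquiv J, ?_⟩
  rw [EuclideanSpace.dist_eq]
  simp only [Equiv.symm_apply_apply]
  have hrm : 0 ≤ r / m := by positivity
  rw [← Real.sqrt_sq hrm, ← Real.sqrt_mul (Nat.cast_nonneg k)]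
  refine Real.sqrt_le_sqrt ?_
  calc ∑ l, dist (p l) (t (J l)) ^ 2 ≤ ∑ _l : Fin k, (r / m) ^ 2 := by
        refine Finset.sum_le_sum fun l _ => ?_
        rw [Real.dist_eq]
        exact pow_le_pow_left₀ (abs_nonneg _) (hJ l) 2
    _ = k * (r / m) ^ 2 := by simp

/-- A map with Lipschitz constant `0` has metric derivatives of rank `0` only. -/
theorem LipschitzOnWith.rank_eq_zero_of_hasMetricDerivAt {n : ℕ} {X : Type*} [MetricSpace X]
    {Ω : Set (EuclideanSpace ℝ (Fin n))} (hΩ : IsOpen Ω) {f : EuclideanSpace ℝ (Fin n) → X}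
    (hf : LipschitzOnWith 0 f Ω) {x : EuclideanSpace ℝ (Fin n)} (hx : x ∈ Ω)
    {σ : Seminorm ℝ (EuclideanSpace ℝ (Fin n))} (hσ : HasMetricDerivAt f σ x) : σ.rank = 0 := by
  have h0 : HasMetricDerivAt f 0 x := by
    refine tendsto_const_nhds.congr' ?_
    filter_upwards [nhdsWithin_le_nhds (hΩ.mem_nhds hx)] with y hy
    have : dist (f y) (f x) = 0 :=
      le_antisymm (by simpa using hf.dist_le_mul y hy x hx) dist_nonneg
    simp [this]
  rw [hσ.unique h0]
  have htop : (0 : Seminorm ℝ (EuclideanSpace ℝ (Fin n))).nullSpace = ⊤ :=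
    Submodule.eq_top_iff'.2 fun v => (rfl : (0 : Seminorm ℝ (EuclideanSpace ℝ (Fin n))) v = 0)
  rw [Seminorm.rank, htop, finrank_top, finrank_euclideanSpace_fin, Nat.sub_self]

theorem Seminorm.finrank_nullSpace_orthogonal {n : ℕ}
    (σ : Seminorm ℝ (EuclideanSpace ℝ (Fin n))) :
    Module.finrank ℝ σ.nullSpaceᗮ = σ.rank := by
  have := σ.nullSpace.finrank_add_finrank_orthogonal
  rw [finrank_euclideanSpace_fin] at this
  rw [Seminorm.rank]
  omega

/-! ### The covering -/

theorem proposition3p4 {n : ℕ} {X : Type*} [MetricSpace X]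
    (Ω : Set (EuclideanSpace ℝ (Fin n))) (hΩ : IsOpen Ω)
    (f : EuclideanSpace ℝ (Fin n) → X) (L : ℝ≥0) (hf : LipschitzOnWith L f Ω) (k : ℕ) :
    ∀ᵐ x ∂(volume : Measure (EuclideanSpace ℝ (Fin n))), x ∈ metricRankSet f Ω k →
      ∀ m : ℕ, 1 ≤ m → ∃ ρ : ℝ, 0 < ρ ∧ ∀ r : ℝ, 0 < r → r < ρ →
        Metric.ball x r ⊆ Ω ∧
        (0 < k → ∃ c : Fin (m ^ k) → X,
          f '' Metric.ball x r ⊆ ⋃ i, Metric.ball (c i) (3 * √(k : ℝ) * L * r / m)) ∧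
        (k = 0 → ∃ c : X, f '' Metric.ball x r ⊆ Metric.ball c (r / m)) := by
  have hae := ae_all_iff.2 fun i : ℕ =>
    hf.ae_dist_add_nullSpace_le hΩ (ε := 1 / ((i : ℝ) + 1)) (by positivity)
  filter_upwards [hae] with x hx hxE m hm
  obtain ⟨hxΩ, σ, hσ, hrank⟩ := hxE
  have hm0 : (0 : ℝ) < m := by exact_mod_cast hm
  have hfin : Module.finrank ℝ σ.nullSpaceᗮ = k := σ.finrank_nullSpace_orthogonal.trans hrank
  obtain ⟨R, hR, hRΩ⟩ := Metric.isOpen_iff.1 hΩ x hxΩ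
  -- the error tolerated in the directions of the null space
  obtain ⟨ε, hε, hεk, hεm⟩ : ∃ ε : ℝ, 0 < ε ∧ (0 < k → ε ≤ √(k : ℝ) * L / m) ∧ ε < 1 / m := by
    rcases Nat.eq_zero_or_pos k with hk | hk
    · exact ⟨1 / m / 2, by positivity, fun h => absurd h (by omega),
        half_lt_self (by positivity)⟩
    -- Positive rank excludes `L = 0`, for which no positive `ε` would fit.
    · have hL : 0 < L := by
        rcases eq_or_lt_of_le (zero_le : 0 ≤ L) with h | h
        · subst h
          have := hf.rank_eq_zero_of_hasMetricDerivAt hΩ hxΩ hσ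
          omega
        · exact h
      have hL' : (0 : ℝ) < L := hL
      have hk' : (0 : ℝ) < k := by exact_mod_cast hk
      have hpos : 0 < √(k : ℝ) * L / m := by positivity
      exact ⟨min (√(k : ℝ) * L / m) (1 / m / 2), by positivity, fun _ => min_le_left _ _,
        (min_le_right _ _).trans_lt (half_lt_self (by positivity))⟩
  obtain ⟨i, hi⟩ := exists_nat_one_div_lt hε
  have hev := hx i hxΩ σ hσ
  rw [eventually_nhdsWithin_iff, Metric.eventually_nhds_iff] at hev
  obtain ⟨ρ, hρ, hev⟩ := hev
  have hproj : ∀ r, 0 < r → r < ρ → ∀ y ∈ Metric.ball x r,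
      dist (f y) (f (x + σ.nullSpaceᗮ.starProjection (y - x))) ≤ 1 / ((i : ℝ) + 1) * r := by
    intro r hr0 hrρ y hy
    have hyx : ‖y - x‖ ≤ r := by rw [← dist_eq_norm]; exact (Metric.mem_ball.1 hy).le
    have hsum : σ.nullSpaceᗮ.starProjection (y - x) + σ.nullSpace.starProjection (y - x)
        = y - x := by
      rw [add_comm]
      exact σ.nullSpace.starProjection_add_starProjection_orthogonal (y - x)
    have := hev (y := r) (by simpa [abs_of_pos hr0] using hrρ) hr0
      (σ.nullSpaceᗮ.starProjection (y - x))
      ((Submodule.norm_starProjection_apply_le _ _).trans hyx)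
      (σ.nullSpace.starProjection (y - x)) (Submodule.starProjection_apply_mem _ _)
      ((Submodule.norm_starProjection_apply_le _ _).trans hyx)
    rwa [add_assoc, hsum, add_sub_cancel] at this
  -- Grid points can leave the ball of radius `r`, but stay within `(√k + 1) * r` of `x`, hence in
  -- `Ω`, where the Lipschitz bound applies.
  refine ⟨min ρ (R / (√(k : ℝ) + 1)), by positivity, fun r hr0 hr => ?_⟩
  have hrρ : r < ρ := hr.trans_le (min_le_left _ _)
  have hrR : r * (√(k : ℝ) + 1) < R :=
    (lt_div_iff₀ (by positivity)).1 (hr.trans_le (min_le_right _ _))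
  have hsk : 0 ≤ √(k : ℝ) * r := by positivity
  have hεr : 1 / ((i : ℝ) + 1) * r < ε * r := by gcongr
  refine ⟨(Metric.ball_subset_ball (by linarith)).trans hRΩ, fun hk => ?_, fun hk => ?_⟩
  · obtain ⟨c, hc⟩ := EuclideanSpace.exists_grid_dist_le k hm hr0
    let b : OrthonormalBasis (Fin k) ℝ σ.nullSpaceᗮ :=
      (stdOrthonormalBasis ℝ σ.nullSpaceᗮ).reindex (finCongr hfin)
    refine ⟨fun l => f (x + (b.repr.symm (c l) : EuclideanSpace ℝ (Fin n))), ?_⟩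
    rintro _ ⟨y, hy, rfl⟩
    have hyx : ‖y - x‖ < r := by rw [← dist_eq_norm]; exact hy
    have hpr := (Submodule.norm_starProjection_apply_le σ.nullSpaceᗮ (y - x)).trans_lt hyx
    have hPdef : (σ.nullSpaceᗮ.orthogonalProjectionOnto (y - x) : EuclideanSpace ℝ (Fin n))
        = σ.nullSpaceᗮ.starProjection (y - x) := rfl
    set P := σ.nullSpaceᗮ.orthogonalProjectionOnto (y - x)
    obtain ⟨l, hl⟩ := hc (b.repr P) (by
      rw [LinearIsometryEquiv.norm_map, Submodule.coe_norm, hPdef]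
      exact hpr)
    refine Set.mem_iUnion.2 ⟨l, Metric.mem_ball.2 ?_⟩
    have hPc : dist (P : EuclideanSpace ℝ (Fin n)) (b.repr.symm (c l)) ≤ √(k : ℝ) * (r / m) := by
      rw [← Subtype.dist_eq, ← b.repr.dist_map, b.repr.apply_symm_apply]
      exact hl
    have hrm : r / m ≤ r := div_le_self hr0.le (by exact_mod_cast hm)
    have hskm : √(k : ℝ) * (r / m) ≤ √(k : ℝ) * r := by gcongr
    have hxP : dist (x + (P : EuclideanSpace ℝ (Fin n))) x < r := by
      rw [dist_eq_norm, add_sub_cancel_left, hPdef]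
      exact hpr
    have hPc' : dist (x + (P : EuclideanSpace ℝ (Fin n))) (x + b.repr.symm (c l))
        ≤ √(k : ℝ) * (r / m) := by
      rwa [dist_add_left]
    have hmemP : x + (P : EuclideanSpace ℝ (Fin n)) ∈ Ω := hRΩ (Metric.mem_ball.2 (by linarith))
    have hmemc : x + (b.repr.symm (c l) : EuclideanSpace ℝ (Fin n)) ∈ Ω := by
      refine hRΩ (Metric.mem_ball.2 ?_)
      have := dist_triangle_left (x + (b.repr.symm (c l) : EuclideanSpace ℝ (Fin n))) x
        (x + (P : EuclideanSpace ℝ (Fin n)))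
      linarith
    have h1 := hproj r hr0 hrρ y hy
    rw [← hPdef] at h1
    have h2 := (hf.dist_le_mul _ hmemP _ hmemc).trans
      (mul_le_mul_of_nonneg_left hPc' L.coe_nonneg)
    have h3 : ε * r ≤ √(k : ℝ) * L / m * r := by gcongr; exact hεk hk
    have h4 : 0 ≤ √(k : ℝ) * L / m * r := by positivity
    -- Projection error and grid error each cost at most `√k * L * r / m`, so the factor `2` already
    -- suffices.
    calc _ ≤ _ := dist_triangle _ (f (x + (P : EuclideanSpace ℝ (Fin n)))) _
      _ < √(k : ℝ) * L / m * r + L * (√(k : ℝ) * (r / m)) := by linarith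
      _ = 2 * (√(k : ℝ) * L / m * r) := by ring
      _ ≤ 3 * (√(k : ℝ) * L / m * r) := by linarith
      _ = 3 * √(k : ℝ) * L * r / m := by ring
  · refine ⟨f x, ?_⟩
    rintro _ ⟨y, hy, rfl⟩
    have hbot : σ.nullSpaceᗮ = ⊥ := Submodule.finrank_eq_zero.1 (hfin.trans hk)
    have hP0 : σ.nullSpaceᗮ.starProjection (y - x) = 0 := by
      have hmem := hbot.le (Submodule.starProjection_apply_mem σ.nullSpaceᗮ (y - x))
      exact (Submodule.mem_bot ℝ).1 hmem
    have h1 := hproj r hr0 hrρ y hy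
    rw [hP0, add_zero] at h1
    refine Metric.mem_ball.2 ?_
    calc dist (f y) (f x) < ε * r := by linarith
      _ ≤ 1 / m * r := by gcongr
      _ = r / m := by ring
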